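/- Let $\mathbb{A}^2_*=\operatorname{Spec}(\mathbb{C}[x,y])\setminus\{(0,0)\}$ be the punctured complex affine plane. A $\mathbb{G}_a$-bundle over a scheme $S$ is a Zariski locally trivial principal bundle under the additive group $\mathbb{G}_a$: a morphism of schemes $\rho:X\to S$ with an action $\mathbb{G}_{a,S}\times_S X\to X$ over $S$ such that every point of $S$ has a Zariski open neighbourhood $U$ with a $\mathbb{G}_a$-equivariant isomorphism $\rho^{-1}(U)\simeq U\times\mathbb{G}_a$ of schemes over $U$, where $\mathbb{G}_a$ acts by translations on the second factor. It is trivial if there is such an isomorphism with $U=S$, that is, a $\mathbb{G}_a$-equivariant isomorphism $X\simeq S\times\mathbb{G}_a$ over $S$. Let $\rho:X\to\mathbb{A}^2_*$ be a $\mathbb{G}_a$-bundle. Then the total space $X$ is an affine scheme if and only if $\rho$ is nontrivial. -/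

import Mathlib

open CategoryTheory Limits AlgebraicGeometry

noncomputable section

universe u

namespace AdditiveBundle

/-- The additive group scheme `𝔾ₐ` over `S`, as an `S`-scheme: the affine line over `S`.
Its `T`-points over `S` are the global functions on `T` (`AffineSpace.homOverEquiv`), and the group
law is the addition of functions. -/
abbrev Ga (S : Scheme.{u}) : Scheme.{u} := 𝔸(PUnit.{u + 1}; S)

/-- The `T`-point `(t, x)` of `𝔾ₐ ×_S X`, for a function `t` on `T` and a `T`-point `x` of `X`. -/
def pair {X S : Scheme.{u}} (ρ : X ⟶ S) {T : Scheme.{u}} (t : Γ(T, ⊤)) (x : T ⟶ X) :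
    T ⟶ pullback (Ga S ↘ S) ρ :=
  pullback.lift (AffineSpace.homOfVector (x ≫ ρ) fun _ => t) x (by simp)

lemma pair_fst {X S : Scheme.{u}} (ρ : X ⟶ S) {T : Scheme.{u}} (t : Γ(T, ⊤)) (x : T ⟶ X) :
    pair ρ t x ≫ pullback.fst (Ga S ↘ S) ρ = AffineSpace.homOfVector (x ≫ ρ) fun _ => t :=
  pullback.lift_fst _ _ _

lemma pair_snd {X S : Scheme.{u}} (ρ : X ⟶ S) {T : Scheme.{u}} (t : Γ(T, ⊤)) (x : T ⟶ X) :
    pair ρ t x ≫ pullback.snd (Ga S ↘ S) ρ = x :=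
  pullback.lift_snd _ _ _

/-- An action over `S` of the group scheme `𝔾ₐ` on an `S`-scheme `ρ : X ⟶ S`: an `S`-morphism
`𝔾ₐ ×_S X ⟶ X` satisfying the laws of a group action, written on `T`-points:
`0 • x = x` and `(s + t) • x = s • (t • x)`. -/
structure GaAction {X S : Scheme.{u}} (ρ : X ⟶ S) where
  act : pullback (Ga S ↘ S) ρ ⟶ X
  act_over : act ≫ ρ = pullback.snd (Ga S ↘ S) ρ ≫ ρ
  zero_act : ∀ {T : Scheme.{u}} (x : T ⟶ X), pair ρ 0 x ≫ act = x
  add_act : ∀ {T : Scheme.{u}} (s t : Γ(T, ⊤)) (x : T ⟶ X),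
    pair ρ (s + t) x ≫ act = pair ρ s (pair ρ t x ≫ act) ≫ act

/-- The addition `𝔾ₐ ×_S 𝔾ₐ ⟶ 𝔾ₐ`, `(t, x) ↦ t + x`. -/
def addition (S : Scheme.{u}) : pullback (Ga S ↘ S) (Ga S ↘ S) ⟶ Ga S :=
  AffineSpace.homOfVector (pullback.snd (Ga S ↘ S) (Ga S ↘ S) ≫ (Ga S ↘ S)) fun i =>
    (pullback.fst (Ga S ↘ S) (Ga S ↘ S)).appTop (AffineSpace.coord S i) +
      (pullback.snd (Ga S ↘ S) (Ga S ↘ S)).appTop (AffineSpace.coord S i)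

lemma appTop_comp {X Y Z : Scheme.{u}} (f : X ⟶ Y) (g : Y ⟶ Z) (v : Γ(Z, ⊤)) :
    f.appTop (g.appTop v) = (f ≫ g).appTop v := rfl

lemma pair_addition {S T : Scheme.{u}} (t : Γ(T, ⊤)) (x : T ⟶ Ga S) :
    pair (Ga S ↘ S) t x ≫ addition S =
      AffineSpace.homOfVector (x ≫ (Ga S ↘ S)) fun i => t + x.appTop (AffineSpace.coord S i) := by
  rw [addition, AffineSpace.comp_homOfVector, ← Category.assoc, pair_snd]
  congr 1
  funext i
  rw [Function.comp_apply, map_add, appTop_comp, appTop_comp, pair_fst, pair_snd,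
    AffineSpace.homOfVector_appTop_coord]

/-- The action of `𝔾ₐ` on itself by translations, `(t, x) ↦ t + x`. -/
def translation (S : Scheme.{u}) : GaAction (Ga S ↘ S) where
  act := addition S
  act_over := AffineSpace.homOfVector_over _ _
  zero_act x := by
    rw [pair_addition]
    ext1 <;> simp
  add_act s t x := by
    rw [pair_addition, pair_addition, pair_addition]
    ext1
    · rw [AffineSpace.homOfVector_over, AffineSpace.homOfVector_over, AffineSpace.homOfVector_over]
    · rw [AffineSpace.homOfVector_appTop_coord, AffineSpace.homOfVector_appTop_coord,
        AffineSpace.homOfVector_appTop_coord, add_assoc]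

namespace GaAction

variable {X S : Scheme.{u}} {ρ : X ⟶ S}

/-- The inclusion of `𝔾ₐ ×_U ρ⁻¹(U)` in `𝔾ₐ ×_S X`. -/
def restrictMap (ρ : X ⟶ S) (U : S.Opens) :
    pullback (Ga U ↘ (U : Scheme.{u})) (ρ ∣_ U) ⟶ pullback (Ga S ↘ S) ρ :=
  pullback.map _ _ _ _ (AffineSpace.map PUnit.{u + 1} U.ι) (ρ ⁻¹ᵁ U).ι U.ι
    (by simp) (by simp)

lemma pair_restrictMap (ρ : X ⟶ S) (U : S.Opens) {T : Scheme.{u}} (t : Γ(T, ⊤))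
    (x : T ⟶ (ρ ⁻¹ᵁ U : X.Opens)) :
    pair (ρ ∣_ U) t x ≫ restrictMap ρ U = pair ρ t (x ≫ (ρ ⁻¹ᵁ U).ι) := by
  apply pullback.hom_ext
  · rw [Category.assoc, restrictMap, pullback.lift_fst, ← Category.assoc, pair_fst, pair_fst]
    ext1
    · simp
    · rw [← appTop_comp, AffineSpace.map_appTop_coord, AffineSpace.homOfVector_appTop_coord,
        AffineSpace.homOfVector_appTop_coord]
  · rw [Category.assoc, restrictMap, pullback.lift_snd, ← Category.assoc, pair_snd, pair_snd]

lemma restrictMap_act_over (a : GaAction ρ) (U : S.Opens) :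
    (restrictMap ρ U ≫ a.act) ≫ ρ =
      (pullback.snd (Ga U ↘ (U : Scheme.{u})) (ρ ∣_ U) ≫ (ρ ∣_ U)) ≫ U.ι := by
  rw [Category.assoc, a.act_over, restrictMap, pullback.lift_snd_assoc, Category.assoc,
    Category.assoc, morphismRestrict_ι]

lemma range_restrictMap_act (a : GaAction ρ) (U : S.Opens) :
    Set.range (restrictMap ρ U ≫ a.act) ⊆ Set.range (ρ ⁻¹ᵁ U).ι := by
  rintro _ ⟨z, rfl⟩
  rw [Scheme.Opens.range_ι]
  change ρ ((restrictMap ρ U ≫ a.act) z) ∈ U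
  rw [← Scheme.Hom.comp_apply, restrictMap_act_over, Scheme.Hom.comp_apply]
  exact Subtype.property _

/-- The restriction of a `𝔾ₐ`-action on `ρ : X ⟶ S` to `ρ⁻¹(U) ⟶ U`, for an open `U ⊆ S`. -/
def restrict (a : GaAction ρ) (U : S.Opens) : GaAction (ρ ∣_ U) where
  act := IsOpenImmersion.lift (ρ ⁻¹ᵁ U).ι (restrictMap ρ U ≫ a.act) (range_restrictMap_act a U)
  act_over := by
    rw [← cancel_mono U.ι, ← restrictMap_act_over a U, Category.assoc, morphismRestrict_ι,
      IsOpenImmersion.lift_fac_assoc]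
  zero_act x := by
    rw [← cancel_mono (ρ ⁻¹ᵁ U).ι, Category.assoc, IsOpenImmersion.lift_fac,
      ← Category.assoc, pair_restrictMap, a.zero_act]
  add_act s t x := by
    rw [← cancel_mono (ρ ⁻¹ᵁ U).ι]
    simp only [Category.assoc, IsOpenImmersion.lift_fac]
    rw [← Category.assoc, pair_restrictMap, a.add_act, ← Category.assoc, pair_restrictMap]
    simp only [Category.assoc, IsOpenImmersion.lift_fac]
    rw [← pair_restrictMap, Category.assoc]

/-- The `𝔾ₐ`-scheme `ρ : X ⟶ S` is trivial: there is an isomorphism `X ≅ 𝔾ₐ` over `S` which is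
equivariant for the given action on `X` and the translation action on `𝔾ₐ`. -/
def IsTrivial (a : GaAction ρ) : Prop :=
  ∃ (e : X ≅ Ga S) (he : e.hom ≫ (Ga S ↘ S) = ρ),
    a.act ≫ e.hom =
      pullback.map (Ga S ↘ S) ρ (Ga S ↘ S) (Ga S ↘ S) (𝟙 _) e.hom (𝟙 _) (by simp) (by simp [he]) ≫
        (translation S).act

end GaAction

/-- A `𝔾ₐ`-bundle over `S`: a Zariski locally trivial principal bundle `proj : total ⟶ S`
under the group scheme `𝔾ₐ`. -/
structure GaBundle (S : Scheme.{u}) where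
  total : Scheme.{u}
  proj : total ⟶ S
  action : GaAction proj
  locally_trivial : ∀ s : S, ∃ U : S.Opens, s ∈ U ∧ (action.restrict U).IsTrivial

/-- A `𝔾ₐ`-bundle is trivial if it is isomorphic, as a `𝔾ₐ`-bundle over `S`, to `𝔾ₐ`
with the translation action. -/
def GaBundle.IsTrivial {S : Scheme.{u}} (B : GaBundle S) : Prop :=
  B.action.IsTrivial

/-- The complex affine plane `Spec ℂ[x, y]`. -/
abbrev plane : Scheme.{0} := Spec (.of (MvPolynomial (Fin 2) ℂ))

/-- The open complement of the origin `x = y = 0` in the affine plane. -/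
def planeMinusOrigin : plane.Opens :=
  ⟨(PrimeSpectrum.zeroLocus {MvPolynomial.X 0, MvPolynomial.X 1})ᶜ,
    (PrimeSpectrum.isClosed_zeroLocus _).isOpen_compl⟩

/-- The punctured complex affine plane as a scheme. -/
abbrev puncturedPlane : Scheme.{0} := planeMinusOrigin

end AdditiveBundle

end

open CategoryTheory Limits AlgebraicGeometry

noncomputable section

namespace AdditiveBundle

/-! ### Points of the product of the additive group with a scheme over the base -/

section

variable {X S : Scheme.{u}} {ρ : X ⟶ S}

/-! Write x, y for the coordinates of the plane. A function f on X has slope r when it is affine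
along the fibres with leading coefficient r, pulled back from the base. The slopes form an ideal I
of Γ(S, O), the annihilator of the class of the bundle in H¹(S, O); slope 1 occurs exactly for a
trivial bundle, and slope 0 means pulled back from S. On the punctured plane Γ(S, O) = ℂ[x, y].

Suppose that ρ is nontrivial, so I is proper. Local triviality puts x and y in the radical of I,
hence some g ∉ I has xg, yg ∈ I. Choose a, b on X with slopes xg, yg. Then xb − ya has slope 0, so
it is a polynomial c + xk₀ + yk₁ with c constant. If c = 0, the Koszul relation for (x, y) gives a
function e with xe = a + k₁ and ye = b − k₀, of slope g, a contradiction. So c is a unit, x and y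
generate the unit ideal of Γ(X, O), and X is affine because the loci x ≠ 0 and y ≠ 0 in X are
(`span_eq_top_of_not_isTrivial`, `isAffine_of_not_isTrivial`).

Conversely, if ρ is trivial and X is affine, then x and y generate the unit ideal on X; a section
carries this back to ℂ[x, y], where it fails at the origin. -/

lemma comp_pair {T' T : Scheme.{u}} (g : T' ⟶ T) (t : Γ(T, ⊤)) (x : T ⟶ X) :
    g ≫ pair ρ t x = pair ρ (g.appTop t) (g ≫ x) := by
  apply pullback.hom_ext
  · rw [Category.assoc, pair_fst, pair_fst, AffineSpace.comp_homOfVector, Category.assoc]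
    rfl
  · rw [Category.assoc, pair_snd, pair_snd]

/-- The coordinate function of the first factor of `𝔾ₐ ×_S X`. -/
def parameter (ρ : X ⟶ S) : Γ(pullback (Ga S ↘ S) ρ, ⊤) :=
  (pullback.fst (Ga S ↘ S) ρ).appTop (AffineSpace.coord S PUnit.unit)

lemma pair_appTop_parameter {T : Scheme.{u}} (t : Γ(T, ⊤)) (x : T ⟶ X) :
    (pair ρ t x).appTop (parameter ρ) = t := by
  rw [parameter, appTop_comp, pair_fst, AffineSpace.homOfVector_appTop_coord]

/-- The universal point: identities between functions of (t, x) need only be tested here. -/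
lemma pair_parameter : pair ρ (parameter ρ) (pullback.snd (Ga S ↘ S) ρ) = 𝟙 _ := by
  apply pullback.hom_ext
  · rw [pair_fst, Category.id_comp]
    ext1
    · rw [AffineSpace.homOfVector_over, pullback.condition]
    · rw [AffineSpace.homOfVector_appTop_coord]; rfl
  · rw [pair_snd, Category.id_comp]

/-! ### Slopes of functions and trivial actions -/

namespace GaAction

/-- The function `f` on `X` satisfies `f (t • x) = f x + r (ρ x) t`. -/
def HasSlope (a : GaAction ρ) (f : Γ(X, ⊤)) (r : Γ(S, ⊤)) : Prop :=
  ∀ ⦃T : Scheme.{u}⦄ (t : Γ(T, ⊤)) (x : T ⟶ X),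
    (pair ρ t x ≫ a.act).appTop f = x.appTop f + (x ≫ ρ).appTop r * t

variable (a : GaAction ρ)

lemma pair_act_proj {T : Scheme.{u}} (t : Γ(T, ⊤)) (x : T ⟶ X) :
    (pair ρ t x ≫ a.act) ≫ ρ = x ≫ ρ := by
  rw [Category.assoc, a.act_over, ← Category.assoc, pair_snd]

variable {a}

lemma hasSlope_of_appTop_act {f : Γ(X, ⊤)} {r : Γ(S, ⊤)}
    (h : a.act.appTop f = (pullback.snd (Ga S ↘ S) ρ).appTop f +
      (pullback.snd (Ga S ↘ S) ρ ≫ ρ).appTop r * parameter ρ) : a.HasSlope f r := by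
  intro T t x
  rw [← appTop_comp, h, map_add, map_mul, pair_appTop_parameter, appTop_comp, appTop_comp,
    ← Category.assoc, pair_snd]

lemma HasSlope.appTop_act {f : Γ(X, ⊤)} {r : Γ(S, ⊤)} (h : a.HasSlope f r) :
    a.act.appTop f = (pullback.snd (Ga S ↘ S) ρ).appTop f +
      (pullback.snd (Ga S ↘ S) ρ ≫ ρ).appTop r * parameter ρ := by
  rw [← h (parameter ρ), pair_parameter, Category.id_comp]

lemma HasSlope.add {f g : Γ(X, ⊤)} {r s : Γ(S, ⊤)} (hf : a.HasSlope f r) (hg : a.HasSlope g s) :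
    a.HasSlope (f + g) (r + s) := by
  intro T t x
  rw [map_add, hf, hg, map_add, map_add]
  ring

lemma HasSlope.smul {f : Γ(X, ⊤)} {r : Γ(S, ⊤)} (hf : a.HasSlope f r) (s : Γ(S, ⊤)) :
    a.HasSlope (ρ.appTop s * f) (s * r) := by
  intro T t x
  rw [map_mul, hf, map_mul, map_mul, appTop_comp, appTop_comp, pair_act_proj]
  ring

variable (a) in
lemma hasSlope_base (s : Γ(S, ⊤)) : a.HasSlope (ρ.appTop s) 0 := by
  intro T t x
  rw [appTop_comp, appTop_comp, pair_act_proj, map_zero, zero_mul, add_zero]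

variable (a) in
/-- The ideal of slopes of functions on a `𝔾ₐ`-scheme. -/
def slopeIdeal : Ideal Γ(S, ⊤) where
  carrier := {r | ∃ f, a.HasSlope f r}
  zero_mem' := ⟨ρ.appTop 0, a.hasSlope_base 0⟩
  add_mem' := fun ⟨f, hf⟩ ⟨g, hg⟩ => ⟨f + g, hf.add hg⟩
  smul_mem' := fun s _ ⟨f, hf⟩ => ⟨ρ.appTop s * f, hf.smul s⟩

lemma pair_restrict_act (a : GaAction ρ) (U : S.Opens) {T : Scheme.{u}} (t : Γ(T, ⊤))
    (x : T ⟶ (ρ ⁻¹ᵁ U : X.Opens)) :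
    (pair (ρ ∣_ U) t x ≫ (a.restrict U).act) ≫ (ρ ⁻¹ᵁ U).ι =
      pair ρ t (x ≫ (ρ ⁻¹ᵁ U).ι) ≫ a.act := by
  rw [Category.assoc, restrict, IsOpenImmersion.lift_fac, ← Category.assoc, pair_restrictMap]

lemma HasSlope.restrict {f : Γ(X, ⊤)} {r : Γ(S, ⊤)} (hf : a.HasSlope f r) (U : S.Opens) :
    (a.restrict U).HasSlope ((ρ ⁻¹ᵁ U).ι.appTop f) (U.ι.appTop r) := by
  intro T t x
  rw [appTop_comp, pair_restrict_act, hf, appTop_comp, appTop_comp, Category.assoc,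
    Category.assoc, morphismRestrict_ι]

/-- A trivialization has an equivariant coordinate and a zero section, and every point is
obtained by translating the zero section by its coordinate. -/
lemma IsTrivial.exists_section (h : a.IsTrivial) :
    ∃ (c : Γ(X, ⊤)) (σ : S ⟶ X), a.HasSlope c 1 ∧ σ ≫ ρ = 𝟙 S ∧
      pair ρ c (ρ ≫ σ) ≫ a.act = 𝟙 X := by
  obtain ⟨e, he, hact⟩ := h
  have key : ∀ {T : Scheme.{u}} (t : Γ(T, ⊤)) (x : T ⟶ X),
      (pair ρ t x ≫ a.act) ≫ e.hom = AffineSpace.homOfVector (x ≫ ρ) fun i =>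
        t + (x ≫ e.hom).appTop (AffineSpace.coord S i) := by
    intro T t x
    have : pair ρ t x ≫ pullback.map (Ga S ↘ S) ρ (Ga S ↘ S) (Ga S ↘ S) (𝟙 _) e.hom (𝟙 _)
        (by simp) (by simp [he]) = pair (Ga S ↘ S) t (x ≫ e.hom) := by
      apply pullback.hom_ext
      · rw [Category.assoc, pullback.lift_fst, pair_fst, Category.comp_id, pair_fst,
          Category.assoc, he]
      · rw [Category.assoc, pullback.lift_snd, pair_snd, ← Category.assoc, pair_snd]
    rw [Category.assoc, hact, ← Category.assoc, this]
    change _ ≫ addition S = _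
    rw [pair_addition, Category.assoc, he]
  refine ⟨e.hom.appTop (AffineSpace.coord S PUnit.unit),
    AffineSpace.homOfVector (𝟙 S) (fun _ => 0) ≫ e.inv, ?_, ?_, ?_⟩
  · intro T t x
    rw [appTop_comp, key, AffineSpace.homOfVector_appTop_coord, map_one, one_mul, add_comm]
    rfl
  · rw [← he, Category.assoc, e.inv_hom_id_assoc, AffineSpace.homOfVector_over]
  · rw [← cancel_mono e.hom, key, Category.id_comp]
    ext1
    · rw [AffineSpace.homOfVector_over, he, Category.assoc, Category.assoc, ← he,
        e.inv_hom_id_assoc, AffineSpace.homOfVector_over, Category.comp_id]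
    · rw [AffineSpace.homOfVector_appTop_coord, Category.assoc, Category.assoc, e.inv_hom_id,
        Category.comp_id, ← appTop_comp, AffineSpace.homOfVector_appTop_coord, map_zero, add_zero]

/-- An equivariant function on a trivial `𝔾ₐ`-scheme is a global coordinate. -/
lemma IsTrivial.isIso_homOfVector (h : a.IsTrivial) {f : Γ(X, ⊤)} (hf : a.HasSlope f 1) :
    IsIso (AffineSpace.homOfVector (n := PUnit.{u + 1}) ρ fun _ => f) := by
  obtain ⟨c, σ, hc, hσ, hid⟩ := h.exists_section
  let π : Ga S ⟶ S := Ga S ↘ S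
  have hf1 : ∀ {T : Scheme.{u}} (t : Γ(T, ⊤)) (x : T ⟶ X),
      (pair ρ t x ≫ a.act).appTop f = x.appTop f + t := by
    intro T t x
    rw [hf, map_one, one_mul]
  -- Every point is its coordinate c applied to the zero section, so f is its value on the zero
  -- section plus c.
  have hfc : f = ρ.appTop (σ.appTop f) + c := by
    have := hf1 c (ρ ≫ σ)
    rw [hid, ← appTop_comp] at this
    exact this
  -- The inverse translates the zero section by the amount that makes f equal to the coordinate of
  -- 𝔾ₐ.
  let t : Γ(Ga S, ⊤) := AffineSpace.coord S PUnit.unit - π.appTop (σ.appTop f)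
  refine ⟨pair ρ t (π ≫ σ) ≫ a.act, ?_, ?_⟩
  · rw [← Category.assoc, comp_pair]
    have h1 : AffineSpace.homOfVector (n := PUnit.{u + 1}) ρ (fun _ => f) ≫ π = ρ :=
      AffineSpace.homOfVector_over _ _
    rw [reassoc_of% h1, map_sub, appTop_comp, h1, AffineSpace.homOfVector_appTop_coord, ← hid]
    congr 2
    nth_rw 1 [hfc]
    rw [add_sub_cancel_left]
  · ext1
    · rw [Category.assoc, AffineSpace.homOfVector_over, pair_act_proj, Category.assoc, hσ,
        Category.comp_id, Category.id_comp]
    · rw [← appTop_comp, AffineSpace.homOfVector_appTop_coord, hf1, ← appTop_comp]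
      change π.appTop (σ.appTop f) + (AffineSpace.coord S _ - π.appTop (σ.appTop f)) = _
      rw [add_sub_cancel]
      rfl

end GaAction

end

/-! ### Functions on the locus where g is invertible -/

lemma ι_appTop_topIso_hom {X : Scheme.{u}} (U : X.Opens) :
    U.ι.appTop ≫ U.topIso.hom = X.presheaf.map (homOfLE le_top).op := by
  rw [Scheme.Opens.ι_appTop]
  exact (X.presheaf.map_comp _ _).symm

/-- The surjective half of Γ(X_g) = Γ(X)_g. -/
lemma exists_ι_appTop_eq_pow_mul (X : Scheme.{u}) [CompactSpace X] [QuasiSeparatedSpace X]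
    (g : Γ(X, ⊤)) (c : Γ((X.basicOpen g).toScheme, ⊤)) :
    ∃ (n : ℕ) (y : Γ(X, ⊤)),
      (X.basicOpen g).ι.appTop y = (X.basicOpen g).ι.appTop g ^ n * c := by
  obtain ⟨n, y, h⟩ := exists_eq_pow_mul_of_isCompact_of_isQuasiSeparated X ⊤
    isCompact_univ isQuasiSeparated_univ g ((X.basicOpen g).topIso.hom c)
  refine ⟨n, y, ?_⟩
  apply (ConcreteCategory.bijective_of_isIso (X.basicOpen g).topIso.hom).1
  rw [map_mul, map_pow, ← CommRingCat.comp_apply, ← CommRingCat.comp_apply, ι_appTop_topIso_hom]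
  exact h

/-- The injective half, for which compactness suffices. -/
lemma exists_pow_mul_eq_zero_of_ι_appTop_eq_zero (X : Scheme.{u}) [CompactSpace X]
    (g d : Γ(X, ⊤)) (h : (X.basicOpen g).ι.appTop d = 0) : ∃ n : ℕ, g ^ n * d = 0 := by
  refine exists_pow_mul_eq_zero_of_res_basicOpen_eq_zero_of_isCompact X isCompact_univ d g ?_
  have h' := congrArg (X.basicOpen g).topIso.hom h
  rw [map_zero, ← CommRingCat.comp_apply, ι_appTop_topIso_hom] at h'
  exact h'

/-! ### Slopes on a locally trivial bundle -/

namespace GaBundle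

variable {S : Scheme.{u}} (B : GaBundle S)

instance isAffineHom_proj : IsAffineHom B.proj := by
  have : IsZariskiLocalAtTarget @IsAffineHom.{u} :=
    @HasAffineProperty.instIsZariskiLocalAtTarget _ _ instHasAffinePropertyIsAffineHomIsAffine
  refine IsZariskiLocalAtTarget.of_forall_exists_morphismRestrict (P := @IsAffineHom.{u}) ?_
  intro s
  obtain ⟨U, hs, e, he, -⟩ := B.locally_trivial s
  exact ⟨U, hs, he ▸ inferInstance⟩

/-- An equivariant function trivializes a `𝔾ₐ`-bundle. -/
lemma isTrivial_of_hasSlope_one {f : Γ(B.total, ⊤)} (hf : B.action.HasSlope f 1) :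
    B.IsTrivial := by
  let φ : B.total ⟶ Ga S := AffineSpace.homOfVector B.proj fun _ => f
  have hφ : φ ≫ (Ga S ↘ S) = B.proj := AffineSpace.homOfVector_over _ _
  have : IsIso φ := by
    apply IsZariskiLocalAtTarget.of_forall_exists_morphismRestrict
      (P := MorphismProperty.isomorphisms Scheme)
    intro y
    obtain ⟨U, hs, hU⟩ := B.locally_trivial ((Ga S ↘ S) y)
    let ψ : (B.proj ⁻¹ᵁ U : B.total.Opens).toScheme ⟶ Ga U :=
      AffineSpace.homOfVector (B.proj ∣_ U) fun _ => (B.proj ⁻¹ᵁ U).ι.appTop f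
    have hi : IsIso ψ := hU.isIso_homOfVector (f := (B.proj ⁻¹ᵁ U).ι.appTop f) (by
      simpa using hf.restrict U)
    have hψ : ψ ≫ (Ga U ↘ U.toScheme) = B.proj ∣_ U := AffineSpace.homOfVector_over _ _
    have hsq : (B.proj ⁻¹ᵁ U).ι ≫ φ = ψ ≫ AffineSpace.map PUnit.{u + 1} U.ι := by
      ext1
      · rw [Category.assoc, hφ, Category.assoc, AffineSpace.map_over, reassoc_of% hψ,
          morphismRestrict_ι]
      · rw [← appTop_comp, ← appTop_comp, AffineSpace.map_appTop_coord,
          AffineSpace.homOfVector_appTop_coord, AffineSpace.homOfVector_appTop_coord]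
    have hm := AffineSpace.isPullback_map (n := PUnit.{u + 1}) U.ι
    -- By pasting of cartesian squares, φ restricted over U is ψ, an isomorphism.
    have hpb : IsPullback (B.proj ⁻¹ᵁ U).ι ψ φ (AffineSpace.map PUnit.{u + 1} U.ι) := by
      refine IsPullback.of_bot ?_ hsq hm
      rw [hψ, hφ]
      exact (isPullback_morphismRestrict B.proj U).flip
    have : IsOpenImmersion (AffineSpace.map PUnit.{u + 1} U.ι) :=
      MorphismProperty.of_isPullback (P := @IsOpenImmersion) hm.flip inferInstance
    refine ⟨(AffineSpace.map PUnit.{u + 1} U.ι).opensRange, ?_, ?_⟩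
    · change y ∈ Set.range (AffineSpace.map PUnit.{u + 1} U.ι)
      rw [← hm.isoPullback_hom_fst, Scheme.Hom.comp_base, TopCat.coe_comp, Set.range_comp,
        (Set.range_eq_univ (f := hm.isoPullback.hom)).mpr hm.isoPullback.hom.surjective,
        Set.image_univ, Scheme.Pullback.range_fst]
      simpa using hs
    · refine ((MorphismProperty.isomorphisms Scheme).arrow_mk_iso_iff
        (morphismRestrictOpensRange φ _)).mpr ?_
      change IsIso (pullback.snd φ (AffineSpace.map PUnit.{u + 1} U.ι))
      rw [← hpb.isoPullback_inv_snd]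
      infer_instance
  have heq : B.action.act ≫ φ = pair (Ga S ↘ S) (parameter B.proj)
      (pullback.snd (Ga S ↘ S) B.proj ≫ φ) ≫ addition S := by
    rw [pair_addition]
    ext1
    · rw [AffineSpace.homOfVector_over, Category.assoc, Category.assoc, hφ, B.action.act_over]
    · rw [AffineSpace.homOfVector_appTop_coord, ← appTop_comp, ← appTop_comp,
        AffineSpace.homOfVector_appTop_coord, hf.appTop_act, map_one, one_mul, add_comm]
  refine ⟨asIso φ, hφ, heq.trans (congrArg (· ≫ addition S) ?_)⟩
  apply pullback.hom_ext
  · rw [pair_fst, pullback.lift_fst, Category.comp_id, Category.assoc, hφ]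
    ext1
    · rw [AffineSpace.homOfVector_over, pullback.condition]
    · rw [AffineSpace.homOfVector_appTop_coord]
      rfl
  · rw [pair_snd, pullback.lift_snd, asIso_hom]

/-- Invariant functions on a `𝔾ₐ`-bundle come from the base. -/
lemma exists_eq_appTop_of_hasSlope_zero {f : Γ(B.total, ⊤)} (hf : B.action.HasSlope f 0) :
    ∃ k : Γ(S, ⊤), f = B.proj.appTop k := by
  choose U hU hT using B.locally_trivial
  choose c σ hc hσ hid using fun s => (hT s).exists_section
  -- The candidate on U s is the value of f along the local zero section. Since f is constant on
  -- orbits, `hk` identifies it with f at any point of the same fibre.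
  let k : ∀ s, Γ((U s).toScheme, ⊤) := fun s => (σ s ≫ (B.proj ⁻¹ᵁ U s).ι).appTop f
  have hk : ∀ s {T : Scheme.{u}} (x : T ⟶ B.total) (y : T ⟶ (U s).toScheme)
      (_ : x ≫ B.proj = y ≫ (U s).ι), x.appTop f = y.appTop (k s) := by
    intro s T x y hxy
    obtain ⟨z, rfl, rfl⟩ : ∃ z : T ⟶ (B.proj ⁻¹ᵁ U s : B.total.Opens).toScheme,
        z ≫ (B.proj ⁻¹ᵁ U s).ι = x ∧ z ≫ B.proj ∣_ U s = y :=
      ⟨(isPullback_morphismRestrict B.proj (U s)).flip.lift x y hxy,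
        (isPullback_morphismRestrict B.proj (U s)).flip.lift_fst _ _ _,
        (isPullback_morphismRestrict B.proj (U s)).flip.lift_snd _ _ _⟩
    have h0 := hf.restrict (U s) (c s) (B.proj ∣_ U s ≫ σ s)
    rw [hid, map_zero, map_zero, zero_mul, add_zero] at h0
    exact congrArg z.appTop h0
  -- Functions are glued as morphisms to 𝔾ₐ over S. On an overlap, `hk s'` is applied to the zero
  -- section of the other chart.
  have hcompat : ∀ s s' : S,
      pullback.fst (U s).ι (U s').ι ≫
          AffineSpace.homOfVector (n := PUnit.{u + 1}) (U s).ι (fun _ => k s) =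
        pullback.snd (U s).ι (U s').ι ≫ AffineSpace.homOfVector (U s').ι fun _ => k s' := by
    intro s s'
    ext1
    · rw [Category.assoc, Category.assoc, AffineSpace.homOfVector_over,
        AffineSpace.homOfVector_over, pullback.condition]
    · rw [← appTop_comp, ← appTop_comp, AffineSpace.homOfVector_appTop_coord,
        AffineSpace.homOfVector_appTop_coord,
        ← hk s' (pullback.fst (U s).ι (U s').ι ≫ σ s ≫ (B.proj ⁻¹ᵁ U s).ι)]
      · rfl
      · rw [Category.assoc, Category.assoc, ← morphismRestrict_ι, reassoc_of% hσ s,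
          pullback.condition]
  let 𝒰 : S.OpenCover := S.openCoverOfIsOpenCover U (by
    rw [TopologicalSpace.IsOpenCover, eq_top_iff]
    exact fun s _ => TopologicalSpace.Opens.mem_iSup.mpr ⟨s, hU s⟩)
  let g : S ⟶ Ga S := 𝒰.glueMorphisms
    (fun s => AffineSpace.homOfVector (U s).ι fun _ => k s) hcompat
  have hg : ∀ s, (U s).ι ≫ g = AffineSpace.homOfVector (U s).ι fun _ => k s :=
    fun s => 𝒰.ι_glueMorphisms _ _ s
  refine ⟨g.appTop (AffineSpace.coord S PUnit.unit), ?_⟩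
  have hglob : AffineSpace.homOfVector (n := PUnit.{u + 1}) B.proj (fun _ => f) =
      AffineSpace.homOfVector B.proj fun i => B.proj.appTop (g.appTop (AffineSpace.coord S i)) := by
    apply Scheme.hom_ext_of_forall
    intro x
    refine ⟨B.proj ⁻¹ᵁ U (B.proj x), hU _, ?_⟩
    ext1
    · simp
    · rw [← appTop_comp, ← appTop_comp, AffineSpace.homOfVector_appTop_coord,
        AffineSpace.homOfVector_appTop_coord,
        hk (B.proj x) _ _ (morphismRestrict_ι _ _).symm, appTop_comp _ g,
        appTop_comp _ (B.proj ≫ g), ← morphismRestrict_ι_assoc, hg, ← appTop_comp _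
        (AffineSpace.homOfVector _ _), AffineSpace.homOfVector_appTop_coord]
  have := congrArg (fun h => h.appTop (AffineSpace.coord S PUnit.unit)) hglob
  simpa only [AffineSpace.homOfVector_appTop_coord] using this

/-- If a `𝔾ₐ`-bundle is trivial over a neighbourhood of the locus where `g` is invertible, then
some power of `g` is a slope. -/
lemma exists_pow_mem_slopeIdeal [CompactSpace S] [QuasiSeparatedSpace S] {U : S.Opens}
    (hU : (B.action.restrict U).IsTrivial) (g : Γ(S, ⊤)) (hg : S.basicOpen g ≤ U) :
    ∃ n : ℕ, g ^ n ∈ B.action.slopeIdeal := by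
  have hX : CompactSpace B.total := QuasiCompact.compactSpace_of_compactSpace B.proj
  have hX' : QuasiSeparatedSpace B.total := quasiSeparatedSpace_of_quasiSeparated B.proj
  have hZ : CompactSpace (pullback (Ga S ↘ S) B.proj : Scheme) :=
    QuasiCompact.compactSpace_of_compactSpace (pullback.snd (Ga S ↘ S) B.proj)
  obtain ⟨c, -, hc, -⟩ := hU.exists_section
  let D := B.total.basicOpen (B.proj.appTop g)
  have hD : D ≤ B.proj ⁻¹ᵁ U := by
    change B.total.basicOpen _ ≤ _
    rw [← Scheme.preimage_basicOpen_top]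
    exact fun x hx => hg hx
  let j := B.total.homOfLE hD
  obtain ⟨n, y, hy⟩ := exists_ι_appTop_eq_pow_mul B.total (B.proj.appTop g) (j.appTop c)
  -- y extends gⁿc: the two agree at every point where g is invertible.
  have key : ∀ {T : Scheme.{u}} (x' : T ⟶ (B.proj ⁻¹ᵁ U : B.total.Opens).toScheme)
      (_ : T.basicOpen ((x' ≫ (B.proj ⁻¹ᵁ U).ι ≫ B.proj).appTop g) = ⊤),
      (x' ≫ (B.proj ⁻¹ᵁ U).ι).appTop y =
        (x' ≫ (B.proj ⁻¹ᵁ U).ι ≫ B.proj).appTop g ^ n * x'.appTop c := by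
    intro T x' hx'
    have hr : Set.range (x' ≫ (B.proj ⁻¹ᵁ U).ι) ⊆ Set.range D.ι := by
      rintro _ ⟨z, rfl⟩
      rw [Scheme.Opens.range_ι]
      have : z ∈ T.basicOpen ((x' ≫ (B.proj ⁻¹ᵁ U).ι ≫ B.proj).appTop g) := by
        rw [hx']
        trivial
      rw [← Category.assoc, ← appTop_comp, ← Scheme.preimage_basicOpen_top] at this
      exact this
    obtain ⟨w, hw⟩ : ∃ w : T ⟶ D.toScheme, w ≫ D.ι = x' ≫ (B.proj ⁻¹ᵁ U).ι :=
      ⟨_, IsOpenImmersion.lift_fac D.ι _ hr⟩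
    have hw' : w ≫ j = x' := by
      rw [← cancel_mono (B.proj ⁻¹ᵁ U).ι, ← hw, Category.assoc, Scheme.homOfLE_ι]
    rw [← Category.assoc, ← hw, ← appTop_comp, hy, map_mul, map_pow, ← hw']
    rfl
  let q := pullback.snd (Ga S ↘ S) B.proj
  -- The failure of y to have slope gⁿ. It vanishes where g is invertible because c has slope 1
  -- there, so some gᵐ kills it and gᵐy has slope gᵐ⁺ⁿ.
  let d := B.action.act.appTop y - (q.appTop y + (q ≫ B.proj).appTop (g ^ n) * parameter B.proj)
  let E := Scheme.basicOpen _ ((q ≫ B.proj).appTop g)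
  have hE : E.toScheme.basicOpen ((E.ι ≫ q ≫ B.proj).appTop g) = ⊤ := by
    rw [← appTop_comp, ← Scheme.preimage_basicOpen_top, eq_top_iff]
    exact fun z _ => z.2
  have hqr : Set.range (E.ι ≫ q) ⊆ Set.range (B.proj ⁻¹ᵁ U).ι := by
    rintro _ ⟨z, rfl⟩
    rw [Scheme.Opens.range_ι]
    apply hg
    have := z.2
    simp only [E, ← Scheme.preimage_basicOpen_top] at this
    exact this
  obtain ⟨w, hw⟩ : ∃ w : E.toScheme ⟶ (B.proj ⁻¹ᵁ U : B.total.Opens).toScheme,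
      w ≫ (B.proj ⁻¹ᵁ U).ι = E.ι ≫ q := ⟨_, IsOpenImmersion.lift_fac _ _ hqr⟩
  have hw2 : w ≫ (B.proj ⁻¹ᵁ U).ι ≫ B.proj = E.ι ≫ q ≫ B.proj := by
    rw [reassoc_of% hw]
  have hact : E.ι ≫ B.action.act =
      (pair (B.proj ∣_ U) (E.ι.appTop (parameter B.proj)) w ≫ (B.action.restrict U).act) ≫
        (B.proj ⁻¹ᵁ U).ι := by
    rw [GaAction.pair_restrict_act, hw, ← comp_pair, pair_parameter, Category.comp_id]
  have hact2 : (pair (B.proj ∣_ U) (E.ι.appTop (parameter B.proj)) w ≫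
      (B.action.restrict U).act) ≫ (B.proj ⁻¹ᵁ U).ι ≫ B.proj = E.ι ≫ q ≫ B.proj := by
    rw [← Category.assoc, ← hact, Category.assoc, B.action.act_over]
  have hd : E.ι.appTop d = 0 := by
    have h1 := key w (by rw [hw2]; exact hE)
    have h2 := key _ (by rw [hact2]; exact hE)
    rw [← hact, hact2, hc, map_one, one_mul] at h2
    rw [hw2, hw] at h1
    rw [map_sub, map_add, map_mul, map_pow, map_pow, appTop_comp, appTop_comp, appTop_comp, h1, h2]
    ring
  obtain ⟨m, hm⟩ := exists_pow_mul_eq_zero_of_ι_appTop_eq_zero _ _ d hd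
  refine ⟨m + n, B.proj.appTop (g ^ m) * y, GaAction.hasSlope_of_appTop_act ?_⟩
  rw [map_mul, appTop_comp, B.action.act_over, map_mul, appTop_comp, pow_add, map_mul]
  have hm' : (q ≫ B.proj).appTop (g ^ m) * d = 0 := by rw [map_pow]; exact hm
  simp only [d, mul_sub, sub_eq_zero] at hm'
  refine hm'.trans ?_
  rw [mul_add, mul_assoc]

end GaBundle

/-! ### Gluing over two basic opens and the Koszul relation -/

lemma exists_glue_of_sup_eq {X : Scheme.{u}} {U V W : X.Opens} (h : U ⊔ V = W)
    (hU : U ≤ W) (hV : V ≤ W) (a : Γ(X, U)) (b : Γ(X, V))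
    (hab : X.presheaf.map (homOfLE (inf_le_left : U ⊓ V ≤ U)).op a =
      X.presheaf.map (homOfLE (inf_le_right : U ⊓ V ≤ V)).op b) :
    ∃ c : Γ(X, W), X.presheaf.map (homOfLE hU).op c = a ∧ X.presheaf.map (homOfLE hV).op c = b := by
  subst h
  exact ⟨(X.sheaf.objSupIsoProdEqLocus U V).inv ⟨⟨a, b⟩, hab⟩,
    X.sheaf.objSupIsoProdEqLocus_inv_fst U V ⟨⟨a, b⟩, hab⟩,
    X.sheaf.objSupIsoProdEqLocus_inv_snd U V ⟨⟨a, b⟩, hab⟩⟩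

lemma isUnit_map_basicOpen (X : Scheme.{u}) (x : Γ(X, ⊤)) :
    IsUnit (X.presheaf.map (homOfLE (le_top : X.basicOpen x ≤ ⊤)).op x) :=
  X.toRingedSpace.isUnit_res_basicOpen x

/-- On a scheme covered by the loci where `x` and `y` are invertible, a function killed by both
`x` and `y` is zero. -/
lemma eq_zero_of_mul_eq_zero {X : Scheme.{u}} {x y : Γ(X, ⊤)}
    (h : X.basicOpen x ⊔ X.basicOpen y = ⊤) {e : Γ(X, ⊤)} (hx : x * e = 0) (hy : y * e = 0) :
    e = 0 := by
  refine X.sheaf.eq_of_locally_eq₂ (homOfLE (le_top : X.basicOpen x ≤ ⊤))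
    (homOfLE (le_top : X.basicOpen y ≤ ⊤)) h.ge e 0 ?_ ?_
  · have := congrArg (X.presheaf.map (homOfLE (le_top : X.basicOpen x ≤ ⊤)).op) hx
    rw [map_mul, map_zero, (isUnit_map_basicOpen X x).mul_right_eq_zero] at this
    exact this.trans (map_zero _).symm
  · have := congrArg (X.presheaf.map (homOfLE (le_top : X.basicOpen y ≤ ⊤)).op) hy
    rw [map_mul, map_zero, (isUnit_map_basicOpen X y).mul_right_eq_zero] at this
    exact this.trans (map_zero _).symm

/-- The Koszul relation: on a scheme covered by the loci where `x` and `y` are invertible,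
`x b = y a` implies that `(a, b)` is a multiple of `(x, y)`. -/
lemma exists_mul_eq_of_mul_eq_mul {X : Scheme.{u}} {x y : Γ(X, ⊤)}
    (h : X.basicOpen x ⊔ X.basicOpen y = ⊤) {a b : Γ(X, ⊤)} (hab : x * b = y * a) :
    ∃ c, x * c = a ∧ y * c = b := by
  let rx := (X.presheaf.map (homOfLE (le_top : X.basicOpen x ≤ ⊤)).op).hom
  let ry := (X.presheaf.map (homOfLE (le_top : X.basicOpen y ≤ ⊤)).op).hom
  let sx := (X.presheaf.map
    (homOfLE (inf_le_left : X.basicOpen x ⊓ X.basicOpen y ≤ X.basicOpen x)).op).hom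
  let sy := (X.presheaf.map
    (homOfLE (inf_le_right : X.basicOpen x ⊓ X.basicOpen y ≤ X.basicOpen y)).op).hom
  have hs : ∀ z, sx (rx z) = sy (ry z) := by
    intro z
    simp only [rx, ry, sx, sy, ← CommRingCat.comp_apply, ← Functor.map_comp]
    rfl
  obtain ⟨u, hu⟩ : IsUnit (rx x) := isUnit_map_basicOpen X x
  obtain ⟨v, hv⟩ : IsUnit (ry y) := isUnit_map_basicOpen X y
  have hux : rx x * ↑u⁻¹ = 1 := by rw [← hu, Units.mul_inv]
  have hvy : ry y * ↑v⁻¹ = 1 := by rw [← hv, Units.mul_inv]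
  -- Glue a/x and b/y, which agree on the overlap because xb = ya.
  obtain ⟨c, hcx, hcy⟩ := exists_glue_of_sup_eq h le_top le_top (rx a * ↑u⁻¹) (ry b * ↑v⁻¹) (by
    change sx _ = sy _
    have h1 := congrArg (fun z => sy (ry z)) hab
    have h2 := congrArg sx hux
    have h3 := congrArg sy hvy
    simp only [map_mul, map_one] at h1 h2 h3 ⊢
    rw [hs] at h2 ⊢
    linear_combination (sy (ry b) * sy ↑v⁻¹) * h2 - sy (ry a) * sx ↑u⁻¹ * h3 -
      (sx ↑u⁻¹ * sy ↑v⁻¹) * h1)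
  change rx c = _ at hcx
  change ry c = _ at hcy
  have hx : rx (x * c - a) = 0 := by
    rw [map_sub, map_mul, hcx]
    linear_combination rx a * hux
  have hy : ry (y * c - b) = 0 := by
    rw [map_sub, map_mul, hcy]
    linear_combination ry b * hvy
  have hab' : ry (x * b) = ry (y * a) := congrArg ry hab
  have hab'' : rx (x * b) = rx (y * a) := congrArg rx hab
  refine ⟨c, sub_eq_zero.mp ?_, sub_eq_zero.mp ?_⟩
  · refine X.sheaf.eq_of_locally_eq₂ (homOfLE (le_top : X.basicOpen x ≤ ⊤))
      (homOfLE (le_top : X.basicOpen y ≤ ⊤)) h.ge _ 0 ?_ ?_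
    · exact hx.trans (map_zero rx).symm
    -- Where y is invertible, yc = b gives y(xc − a) = xb − ya = 0.
    · refine Eq.trans ?_ (map_zero ry).symm
      change ry (x * c - a) = 0
      simp only [map_sub, map_mul] at hy hab' ⊢
      linear_combination (-(ry x * ry c - ry a)) * hvy + ry x * ↑v⁻¹ * hy + ↑v⁻¹ * hab'
  · refine X.sheaf.eq_of_locally_eq₂ (homOfLE (le_top : X.basicOpen x ≤ ⊤))
      (homOfLE (le_top : X.basicOpen y ≤ ⊤)) h.ge _ 0 ?_ ?_
    · refine Eq.trans ?_ (map_zero rx).symm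
      change rx (y * c - b) = 0
      simp only [map_sub, map_mul] at hx hab'' ⊢
      linear_combination (-(rx y * rx c - rx b)) * hux + rx y * ↑u⁻¹ * hx - ↑u⁻¹ * hab''
    · exact hy.trans (map_zero ry).symm

lemma preimage_sup_basicOpen_eq_top {X Y : Scheme.{u}} (f : X ⟶ Y) {x y : Γ(Y, ⊤)}
    (h : Y.basicOpen x ⊔ Y.basicOpen y = ⊤) :
    X.basicOpen (f.appTop x) ⊔ X.basicOpen (f.appTop y) = ⊤ := by
  rw [← Scheme.preimage_basicOpen_top, ← Scheme.preimage_basicOpen_top]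
  exact congrArg (fun U : Y.Opens => f ⁻¹ᵁ U) h

/-- Slopes may be computed after multiplication by functions on the base whose loci of
invertibility form a cover. -/
lemma GaAction.HasSlope.of_mul {X S : Scheme.{u}} {ρ : X ⟶ S} {a : GaAction ρ} {x y : Γ(S, ⊤)}
    (h : S.basicOpen x ⊔ S.basicOpen y = ⊤) {e : Γ(X, ⊤)} {r : Γ(S, ⊤)}
    (hx : a.HasSlope (ρ.appTop x * e) (x * r)) (hy : a.HasSlope (ρ.appTop y * e) (y * r)) :
    a.HasSlope e r := by
  intro T t p
  rw [← sub_eq_zero]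
  have hx' := hx t p
  have hy' := hy t p
  rw [map_mul, appTop_comp, a.pair_act_proj, map_mul, map_mul, appTop_comp] at hx' hy'
  -- The defect of the slope law for e is killed by x and y on T, and their invertibility loci pull
  -- back to a cover of T.
  refine eq_zero_of_mul_eq_zero (preimage_sup_basicOpen_eq_top (p ≫ ρ) h) ?_ ?_
  · linear_combination hx'
  · linear_combination hy'

/-- A proper ideal whose radical contains `x` and `y` has a nonzero class killed by both. -/
lemma exists_notMem_and_mul_mem {R : Type*} [CommRing R] {I : Ideal R} (hI : I ≠ ⊤) {x y : R}
    (hx : x ∈ I.radical) (hy : y ∈ I.radical) : ∃ h, h ∉ I ∧ x * h ∈ I ∧ y * h ∈ I := by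
  classical
  have key : ∀ (z h : R), z ∈ I.radical → h ∉ I → ∃ n : ℕ, z ^ n * h ∉ I ∧ z * (z ^ n * h) ∈ I := by
    intro z h ⟨n, hn⟩ hh
    have hex : ∃ n : ℕ, z ^ n * h ∈ I := ⟨n, I.mul_mem_right _ hn⟩
    -- The least exponent landing in I is positive since h ∉ I; the power just below it works.
    obtain ⟨m, hm⟩ : ∃ m, Nat.find hex = m + 1 := Nat.exists_eq_succ_of_ne_zero fun h0 => by
      have := Nat.find_spec hex
      rw [h0, pow_zero, one_mul] at this
      exact hh this
    refine ⟨m, Nat.find_min hex (by omega), ?_⟩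
    have := Nat.find_spec hex
    rwa [hm, pow_succ', mul_assoc] at this
  obtain ⟨n, hn, hn'⟩ := key x 1 hx ((Ideal.ne_top_iff_one I).mp hI)
  -- Multiplying by a further power of y preserves being killed by x modulo I.
  obtain ⟨m, hm, hm'⟩ := key y _ hy hn
  refine ⟨_, hm, ?_, hm'⟩
  rw [mul_left_comm]
  exact I.mul_mem_left _ hn'

/-! ### Functions on the punctured plane -/

/-- Polynomials as functions on the punctured plane. -/
def polynomialFunction : MvPolynomial (Fin 2) ℂ →+* Γ(puncturedPlane, ⊤) :=
  planeMinusOrigin.ι.appTop.hom.comp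
    (Scheme.ΓSpecIso (.of (MvPolynomial (Fin 2) ℂ))).inv.hom

lemma mem_planeMinusOrigin_iff (p : plane) : p ∈ planeMinusOrigin ↔
    ¬ (MvPolynomial.X 0 ∈ PrimeSpectrum.asIdeal p ∧ MvPolynomial.X 1 ∈ PrimeSpectrum.asIdeal p) := by
  change ¬ ({MvPolynomial.X 0, MvPolynomial.X 1} : Set (MvPolynomial (Fin 2) ℂ)) ⊆
    PrimeSpectrum.asIdeal p ↔ _
  rw [Set.pair_subset_iff]
  rfl

lemma basicOpen_polynomialFunction (f : MvPolynomial (Fin 2) ℂ) :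
    puncturedPlane.basicOpen (polynomialFunction f) =
      planeMinusOrigin.ι ⁻¹ᵁ (PrimeSpectrum.basicOpen f : plane.Opens) := by
  rw [← basicOpen_eq_of_affine (R := .of (MvPolynomial (Fin 2) ℂ)),
    Scheme.preimage_basicOpen_top]
  rfl

lemma mem_basicOpen_polynomialFunction {f : MvPolynomial (Fin 2) ℂ} {s : puncturedPlane} :
    s ∈ puncturedPlane.basicOpen (polynomialFunction f) ↔ f ∉ PrimeSpectrum.asIdeal s.1 := by
  rw [basicOpen_polynomialFunction]
  rfl

lemma sup_basicOpen_polynomialFunction_X :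
    puncturedPlane.basicOpen (polynomialFunction (.X 0)) ⊔
      puncturedPlane.basicOpen (polynomialFunction (.X 1)) = ⊤ := by
  rw [eq_top_iff]
  intro s _
  have := (mem_planeMinusOrigin_iff s.1).mp s.2
  rw [not_and_or] at this
  exact this.imp mem_basicOpen_polynomialFunction.mpr mem_basicOpen_polynomialFunction.mpr

lemma basicOpen_X_le_planeMinusOrigin (i : Fin 2) :
    (PrimeSpectrum.basicOpen (MvPolynomial.X i : MvPolynomial (Fin 2) ℂ) : plane.Opens) ≤
      planeMinusOrigin := by
  intro p hp
  refine (mem_planeMinusOrigin_iff p).mpr ?_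
  fin_cases i
  · exact fun h => hp h.1
  · exact fun h => hp h.2

lemma isAffineOpen_basicOpen_polynomialFunction_X (i : Fin 2) :
    IsAffineOpen (puncturedPlane.basicOpen (polynomialFunction (.X i))) := by
  rw [basicOpen_polynomialFunction, ← basicOpen_eq_of_affine (R := .of (MvPolynomial (Fin 2) ℂ))]
  refine ((isAffineOpen_top plane).basicOpen _).preimage_of_isOpenImmersion _ ?_
  rw [Scheme.Opens.opensRange_ι, basicOpen_eq_of_affine (R := .of (MvPolynomial (Fin 2) ℂ))]
  exact basicOpen_X_le_planeMinusOrigin i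

lemma exists_basicOpen_polynomialFunction_le {s : puncturedPlane} {V : puncturedPlane.Opens}
    (hs : s ∈ V) : ∃ f, s ∈ puncturedPlane.basicOpen (polynomialFunction f) ∧
      puncturedPlane.basicOpen (polynomialFunction f) ≤ V := by
  have hW : s.1 ∈ planeMinusOrigin.ι ''ᵁ V := ⟨s, hs, rfl⟩
  obtain ⟨_, ⟨_, ⟨f, rfl⟩, rfl⟩, hf, hle⟩ :=
    PrimeSpectrum.isBasis_basic_opens.exists_subset_of_mem_open hW (planeMinusOrigin.ι ''ᵁ V).2
  refine ⟨f, mem_basicOpen_polynomialFunction.mpr hf, fun t ht => ?_⟩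
  obtain ⟨t', ht', he⟩ := hle (mem_basicOpen_polynomialFunction.mp ht)
  rwa [← planeMinusOrigin.ι.injective he]

instance : Nonempty puncturedPlane :=
  ⟨⟨(⊥ : PrimeSpectrum (MvPolynomial (Fin 2) ℂ)), (mem_planeMinusOrigin_iff _).mpr fun h =>
    MvPolynomial.X_ne_zero (R := ℂ) (0 : Fin 2) h.1⟩⟩

instance : IsIntegral puncturedPlane := isIntegral_of_isOpenImmersion planeMinusOrigin.ι

instance : CompactSpace puncturedPlane := by
  have : TopologicalSpace.NoetherianSpace plane :=
    inferInstanceAs (TopologicalSpace.NoetherianSpace (PrimeSpectrum (MvPolynomial (Fin 2) ℂ)))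
  exact isCompact_iff_compactSpace.mp
    (TopologicalSpace.NoetherianSpace.isCompact (planeMinusOrigin : Set plane))

instance : QuasiSeparatedSpace puncturedPlane :=
  quasiSeparatedSpace_of_quasiSeparated planeMinusOrigin.ι

/-- A nonzero polynomial is nonzero at the generic point, which survives the puncture. -/
lemma polynomialFunction_injective : Function.Injective polynomialFunction := by
  rw [injective_iff_map_eq_zero]
  intro f hf
  by_contra hne
  let s : puncturedPlane := ⟨(⊥ : PrimeSpectrum (MvPolynomial (Fin 2) ℂ)),
    (mem_planeMinusOrigin_iff _).mpr fun h => MvPolynomial.X_ne_zero (R := ℂ) (0 : Fin 2) h.1⟩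
  have hs : s ∈ puncturedPlane.basicOpen (polynomialFunction f) :=
    mem_basicOpen_polynomialFunction.mpr hne
  rw [hf, Scheme.basicOpen_zero] at hs
  exact hs

/-- The locus where the coordinate is invertible is the same in the plane and the punctured plane;
clear denominators there, then use integrality to return to the whole punctured plane. -/
lemma exists_pow_mul_eq_polynomialFunction (i : Fin 2) (s : Γ(puncturedPlane, ⊤)) :
    ∃ (n : ℕ) (p : MvPolynomial (Fin 2) ℂ),
      polynomialFunction (.X i) ^ n * s = polynomialFunction p := by
  let R : CommRingCat := .of (MvPolynomial (Fin 2) ℂ)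
  let g : Γ(plane, ⊤) := (Scheme.ΓSpecIso R).inv (MvPolynomial.X i : MvPolynomial (Fin 2) ℂ)
  have hg : plane.basicOpen g ≤ planeMinusOrigin := by
    change plane.basicOpen ((Scheme.ΓSpecIso R).inv _) ≤ _
    rw [basicOpen_eq_of_affine (R := R)]
    exact basicOpen_X_le_planeMinusOrigin i
  let j := plane.homOfLE hg
  obtain ⟨n, y, hy⟩ := exists_ι_appTop_eq_pow_mul plane g (j.appTop s)
  obtain ⟨p, rfl⟩ : ∃ p : MvPolynomial (Fin 2) ℂ, (Scheme.ΓSpecIso R).inv p = y :=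
    ⟨(Scheme.ΓSpecIso R).hom y, Iso.hom_inv_id_apply (Scheme.ΓSpecIso R) y⟩
  refine ⟨n, p, sub_eq_zero.mp ?_⟩
  let E := puncturedPlane.basicOpen (polynomialFunction (.X i))
  have hE : Set.range (E.ι ≫ planeMinusOrigin.ι) ⊆ Set.range (plane.basicOpen g).ι := by
    rintro _ ⟨z, rfl⟩
    rw [Scheme.Opens.range_ι]
    have : z.1 ∈ puncturedPlane.basicOpen (polynomialFunction (.X i)) := z.2
    rw [basicOpen_polynomialFunction,
      ← basicOpen_eq_of_affine (R := .of (MvPolynomial (Fin 2) ℂ))] at this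
    exact this
  obtain ⟨w, hw⟩ : ∃ w : E.toScheme ⟶ (plane.basicOpen g).toScheme,
      w ≫ (plane.basicOpen g).ι = E.ι ≫ planeMinusOrigin.ι :=
    ⟨_, IsOpenImmersion.lift_fac _ _ hE⟩
  have hwj : w ≫ j = E.ι := by
    rw [← cancel_mono planeMinusOrigin.ι, Category.assoc, Scheme.homOfLE_ι, hw]
  have hd : E.ι.appTop (polynomialFunction (.X i) ^ n * s - polynomialFunction p) = 0 := by
    have h := congrArg w.appTop hy
    rw [map_mul, map_pow, appTop_comp, appTop_comp, appTop_comp, hwj, hw] at h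
    rw [map_sub, map_mul, map_pow, sub_eq_zero]
    exact h.symm
  obtain ⟨m, hm⟩ := exists_pow_mul_eq_zero_of_ι_appTop_eq_zero _ _ _ hd
  exact (mul_eq_zero.mp hm).resolve_left (pow_ne_zero _
    ((map_ne_zero_iff _ polynomialFunction_injective).mpr (MvPolynomial.X_ne_zero i)))

/-- Functions on the punctured plane extend to polynomials. -/
lemma polynomialFunction_surjective : Function.Surjective polynomialFunction := by
  intro s
  obtain ⟨n, p, hp⟩ := exists_pow_mul_eq_polynomialFunction 0 s
  obtain ⟨m, q, hq⟩ := exists_pow_mul_eq_polynomialFunction 1 s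
  have hpq : MvPolynomial.X 1 ^ m * p = MvPolynomial.X 0 ^ n * q := by
    apply polynomialFunction_injective
    rw [map_mul, map_mul, ← hp, ← hq, map_pow, map_pow]
    ring
  -- x is prime and does not divide a power of y, so both denominators cancel.
  have hdvd : (MvPolynomial.X 0 : MvPolynomial (Fin 2) ℂ) ^ n ∣ p := by
    refine MvPolynomial.X_prime.pow_dvd_of_dvd_mul_left n (fun h => ?_) ⟨q, hpq⟩
    have := MvPolynomial.X_prime.dvd_of_dvd_pow h
    rw [MvPolynomial.X_dvd_X] at this
    simp at this
  obtain ⟨r, rfl⟩ := hdvd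
  refine ⟨r, ?_⟩
  have hne : polynomialFunction (.X 0) ^ n ≠ 0 :=
    pow_ne_zero _ ((map_ne_zero_iff _ polynomialFunction_injective).mpr (MvPolynomial.X_ne_zero 0))
  apply mul_left_cancel₀ hne
  rw [hp, map_mul, map_pow]

lemma exists_eq_C_add (k : MvPolynomial (Fin 2) ℂ) :
    ∃ (c : ℂ) (k₀ k₁ : MvPolynomial (Fin 2) ℂ),
      k = .C c + .X 0 * k₀ + .X 1 * k₁ := by
  induction k using MvPolynomial.induction_on with
  | C c => exact ⟨c, 0, 0, by simp⟩
  | add p q hp hq =>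
    obtain ⟨c, p₀, p₁, rfl⟩ := hp
    obtain ⟨d, q₀, q₁, rfl⟩ := hq
    exact ⟨c + d, p₀ + q₀, p₁ + q₁, by rw [MvPolynomial.C_add]; ring⟩
  | mul_X p i _ =>
    fin_cases i
    · exact ⟨0, p, 0, by simp [mul_comm]⟩
    · exact ⟨0, 0, p, by simp [mul_comm]⟩

/-- A relation ax + by = 1 would hold between polynomials, and its constant term is 0 = 1. -/
lemma span_polynomialFunction_X_ne_top :
    Ideal.span {polynomialFunction (.X 0), polynomialFunction (.X 1)} ≠ ⊤ := by
  rw [Ideal.ne_top_iff_one, Ideal.mem_span_pair]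
  rintro ⟨a, b, h⟩
  obtain ⟨a, rfl⟩ := polynomialFunction_surjective a
  obtain ⟨b, rfl⟩ := polynomialFunction_surjective b
  rw [← map_mul, ← map_mul, ← map_add, ← map_one polynomialFunction] at h
  have := congrArg MvPolynomial.constantCoeff (polynomialFunction_injective h)
  simp at this

/-! ### Affineness of the total space -/

namespace GaBundle

variable (B : GaBundle puncturedPlane)

lemma not_isAffine_of_isTrivial (h : B.IsTrivial) : ¬ IsAffine B.total := by
  intro _
  obtain ⟨-, σ, -, hσ, -⟩ := GaAction.IsTrivial.exists_section h
  have hcov := preimage_sup_basicOpen_eq_top B.proj sup_basicOpen_polynomialFunction_X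
  have hspan : Ideal.span {B.proj.appTop (polynomialFunction (.X 0)),
      B.proj.appTop (polynomialFunction (.X 1))} = ⊤ := by
    rw [← (isAffineOpen_top B.total).iSup_basicOpen_eq_self_iff, iSup_subtype, iSup_pair]
    exact hcov
  apply span_polynomialFunction_X_ne_top
  have := congrArg (Ideal.map σ.appTop.hom) hspan
  rw [Ideal.map_span, Ideal.map_top, Set.image_pair] at this
  rw [← this]
  have hσ' : ∀ z, σ.appTop.hom (B.proj.appTop z) = z := by
    intro z
    change (σ ≫ B.proj).appTop z = z
    rw [hσ]
    rfl
  rw [hσ', hσ']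

/-- A prime containing I but not the coordinate is a point of the punctured plane. The bundle is
trivial on a basic open neighbourhood of it, so a power of a polynomial outside the prime is a
slope, which is absurd. -/
lemma X_mem_radical_slopeIdeal (i : Fin 2) :
    MvPolynomial.X i ∈ (B.action.slopeIdeal.comap polynomialFunction).radical := by
  rw [Ideal.radical_eq_sInf, Ideal.mem_sInf]
  rintro p ⟨hp, hprime⟩
  by_contra hX
  let s : puncturedPlane := ⟨⟨p, hprime⟩, basicOpen_X_le_planeMinusOrigin i hX⟩
  obtain ⟨U, hsU, hU⟩ := B.locally_trivial s
  obtain ⟨f, hsf, hfU⟩ := exists_basicOpen_polynomialFunction_le hsU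
  obtain ⟨n, hn⟩ := B.exists_pow_mem_slopeIdeal hU _ hfU
  rw [← map_pow] at hn
  exact mem_basicOpen_polynomialFunction.mp hsf (hprime.mem_of_pow_mem n (hp hn))

lemma span_eq_top_of_not_isTrivial (h : ¬ B.IsTrivial) :
    Ideal.span {B.proj.appTop (polynomialFunction (.X 0)),
      B.proj.appTop (polynomialFunction (.X 1))} = ⊤ := by
  have hI : B.action.slopeIdeal.comap polynomialFunction ≠ ⊤ := by
    rw [Ideal.ne_top_iff_one, Ideal.mem_comap, map_one]
    rintro ⟨f, hf⟩
    exact h (B.isTrivial_of_hasSlope_one hf)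
  obtain ⟨g, hg, ⟨a, ha⟩, ⟨b, hb⟩⟩ := exists_notMem_and_mul_mem hI
    (B.X_mem_radical_slopeIdeal 0) (B.X_mem_radical_slopeIdeal 1)
  rw [map_mul] at ha hb
  set x := polynomialFunction (.X 0) with hx
  set y := polynomialFunction (.X 1) with hy
  set γ := polynomialFunction g with hγ
  -- The slope is x(yg) − y(xg) = 0.
  have hinv : B.action.HasSlope (B.proj.appTop x * b + B.proj.appTop (-y) * a) 0 := by
    convert (hb.smul x).add (ha.smul (-y)) using 1
    ring
  obtain ⟨k, hk⟩ := B.exists_eq_appTop_of_hasSlope_zero hinv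
  obtain ⟨k, rfl⟩ := polynomialFunction_surjective k
  obtain ⟨c, k₀, k₁, rfl⟩ := exists_eq_C_add k
  rw [map_add, map_add, map_mul, map_mul, map_add, map_add, map_mul, map_mul, map_neg, ← hx,
    ← hy] at hk
  set ξ := B.proj.appTop x with hξ
  set η := B.proj.appTop y with hη
  -- `hk` now reads ξ(b − k₀) − η(a + k₁) = c, with k₀, k₁ pulled back to X.
  by_cases hc : c = 0
  · exfalso
    rw [hc, map_zero, map_zero, map_zero] at hk
    obtain ⟨e, hex, hey⟩ := exists_mul_eq_of_mul_eq_mul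
      (preimage_sup_basicOpen_eq_top B.proj sup_basicOpen_polynomialFunction_X)
      (a := a + B.proj.appTop (polynomialFunction k₁))
      (b := b - B.proj.appTop (polynomialFunction k₀)) (by linear_combination hk)
    refine hg ⟨e, GaAction.HasSlope.of_mul sup_basicOpen_polynomialFunction_X ?_ ?_⟩
    · rw [hex]
      simpa using ha.add (B.action.hasSlope_base (polynomialFunction k₁))
    · rw [hey, sub_eq_add_neg, ← map_neg]
      simpa using hb.add (B.action.hasSlope_base (-polynomialFunction k₀))
  · have hunit : IsUnit (B.proj.appTop (polynomialFunction (.C c))) :=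
      (((Ne.isUnit hc).map MvPolynomial.C).map polynomialFunction).map B.proj.appTop.hom
    refine Ideal.eq_top_of_isUnit_mem _ (Ideal.mem_span_pair.mpr
      ⟨b - B.proj.appTop (polynomialFunction k₀), -a - B.proj.appTop (polynomialFunction k₁), ?_⟩)
      hunit
    linear_combination hk

lemma isAffine_of_not_isTrivial (h : ¬ B.IsTrivial) : IsAffine B.total := by
  refine isAffine_of_isAffineOpen_basicOpen _ (B.span_eq_top_of_not_isTrivial h) ?_
  rintro _ (rfl | rfl) <;> rw [← Scheme.preimage_basicOpen_top]
  · exact (isAffineOpen_basicOpen_polynomialFunction_X 0).preimage B.proj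
  · exact (isAffineOpen_basicOpen_polynomialFunction_X 1).preimage B.proj

end GaBundle

end AdditiveBundle

end

theorem mainTheorem5 (B : AdditiveBundle.GaBundle AdditiveBundle.puncturedPlane) :
    AlgebraicGeometry.IsAffine B.total ↔ ¬ B.IsTrivial :=
  ⟨fun h ht => B.not_isAffine_of_isTrivial ht h, B.isAffine_of_not_isTrivial⟩
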